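/- All categories are small, and $\simeq$ denotes homotopy equivalence of topological spaces. For a category $\mathsf{C}$, the classifying space $B\mathsf{C}$ is the geometric realization of the nerve of $\mathsf{C}$. Let $L:\mathsf{C}\rightleftarrows\mathsf{D}:U$ be a pair of adjoint functors, with $L$ left adjoint to $U$, and let $P:\mathsf{C}^{\mathrm{op}}\times\mathsf{D}\to\mathrm{Set}$ be the associated profunctor, $P(c,d)=\hom_{\mathsf{C}}(c,Ud)\cong\hom_{\mathsf{D}}(Lc,d)$. Let $\mathsf{G}$ be the graph of $P$: the category whose objects are triples $(c,d,\varphi)$ with $c\in\mathsf{C}$, $d\in\mathsf{D}$ and $\varphi\in P(c,d)$, and whose morphisms $(c,d,\varphi)\to(c',d',\varphi')$ are the pairs of morphisms $f:c\to c'$ in $\mathsf{C}$ and $g:d\to d'$ in $\mathsf{D}$ such that $g\varphi=\varphi' f$ in $P(c,d')$, where $g\varphi=P(\mathrm{id}_c,g)(\varphi)$ and $\varphi' f=P(f,\mathrm{id}_{d'})(\varphi')$. Then $$B\mathsf{C}\simeq B\mathsf{G}\simeq B\mathsf{D}.$$ -/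

import Mathlib

open CategoryTheory Opposite
open scoped ContinuousMap

universe u

section

variable {C D : Type u} [SmallCategory C] [SmallCategory D]

/-- The classifying space `BC` of a small category: the geometric realization of its nerve. -/
noncomputable abbrev ClassifyingSpace (C : Type u) [SmallCategory C] : TopCat.{u} :=
  SSet.toTop.obj (nerve C)

/-- A (set-valued) profunctor from `D` to `C`: a functor `Cᵒᵖ × D ⥤ Set`. The elements of
`P.obj (op c, d)` are the heteromorphisms from `c` to `d`. -/
abbrev HetProfunctor (C D : Type u) [SmallCategory C] [SmallCategory D] : Type (u + 1) :=
  Cᵒᵖ × D ⥤ Type u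

namespace HetProfunctor

variable (P : HetProfunctor C D)

/-- The heteromorphisms from `c` to `d`. -/
abbrev Het (c : C) (d : D) : Type u := P.obj (op c, d)

variable {P}

/-- The action `φ ↦ φ f` of a morphism `f : c' ⟶ c` on heteromorphisms from `c` to `d`. -/
def precomp {c' c : C} {d : D} (f : c' ⟶ c) (φ : P.Het c d) : P.Het c' d :=
  P.map (Prod.mkHom f.op (𝟙 d)) φ

/-- The action `φ ↦ g φ` of a morphism `g : d ⟶ d'` on heteromorphisms from `c` to `d`. -/
def postcomp {c : C} {d d' : D} (g : d ⟶ d') (φ : P.Het c d) : P.Het c d' :=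
  P.map (Prod.mkHom (𝟙 (op c)) g) φ

@[simp]
lemma precomp_id {c : C} {d : D} (φ : P.Het c d) : precomp (𝟙 c) φ = φ :=
  ConcreteCategory.congr_hom (P.map_id (op c, d)) φ

@[simp]
lemma postcomp_id {c : C} {d : D} (φ : P.Het c d) : postcomp (𝟙 d) φ = φ :=
  ConcreteCategory.congr_hom (P.map_id (op c, d)) φ

lemma precomp_comp {c'' c' c : C} {d : D} (f' : c'' ⟶ c') (f : c' ⟶ c) (φ : P.Het c d) :
    precomp (f' ≫ f) φ = precomp f' (precomp f φ) := by
  simp only [precomp, ← ConcreteCategory.comp_apply, ← P.map_comp]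
  congr 2
  ext
  all_goals simp

lemma postcomp_comp {c : C} {d d' d'' : D} (g : d ⟶ d') (g' : d' ⟶ d'') (φ : P.Het c d) :
    postcomp (g ≫ g') φ = postcomp g' (postcomp g φ) := by
  simp only [postcomp, ← ConcreteCategory.comp_apply, ← P.map_comp]
  congr 2
  ext
  all_goals simp

lemma precomp_postcomp {c' c : C} {d d' : D} (f : c' ⟶ c) (g : d ⟶ d') (φ : P.Het c d) :
    precomp f (postcomp g φ) = postcomp g (precomp f φ) := by
  simp only [precomp, postcomp, ← ConcreteCategory.comp_apply, ← P.map_comp]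
  congr 2
  ext
  all_goals simp

variable (P)

/-- The objects of the graph of a profunctor: triples `(c, d, φ)` with `φ` a heteromorphism
from `c` to `d`. -/
structure Graph : Type u where
  /-- The source of the heteromorphism. -/
  c : C
  /-- The target of the heteromorphism. -/
  d : D
  /-- The heteromorphism. -/
  φ : P.Het c d

namespace Graph

variable {P}

/-- A morphism `(c, d, φ) ⟶ (c', d', φ')` of the graph: a pair `f : c ⟶ c'`, `g : d ⟶ d'` with
`g φ = φ' f`. -/
@[ext]
structure Hom (X Y : P.Graph) : Type u where
  /-- The component in `C`. -/
  f : X.c ⟶ Y.c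
  /-- The component in `D`. -/
  g : X.d ⟶ Y.d
  w : postcomp g X.φ = precomp f Y.φ

/-- The graph (the category of heteromorphisms) of a profunctor. -/
instance : SmallCategory P.Graph where
  Hom X Y := Hom X Y
  id X := ⟨𝟙 _, 𝟙 _, by simp⟩
  comp a b := ⟨a.f ≫ b.f, a.g ≫ b.g, by
    rw [postcomp_comp, a.w, ← precomp_postcomp, b.w, precomp_comp]⟩
  id_comp a := Hom.ext (Category.id_comp _) (Category.id_comp _)
  comp_id a := Hom.ext (Category.comp_id _) (Category.comp_id _)
  assoc a b c := Hom.ext (Category.assoc _ _ _) (Category.assoc _ _ _)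

end Graph

/-- The profunctor `(c, d) ↦ hom_C(c, U d)`, with `(f, g)` acting by `ψ ↦ U g ∘ ψ ∘ f`. -/
@[simps]
def ofRight (U : D ⥤ C) : HetProfunctor C D where
  obj X := X.1.unop ⟶ U.obj X.2
  map h := ↾fun ψ => h.1.unop ≫ ψ ≫ U.map h.2

/-- The profunctor `(c, d) ↦ hom_D(L c, d)`, with `(f, g)` acting by `ψ ↦ g ∘ ψ ∘ L f`. -/
@[simps]
def ofLeft (L : C ⥤ D) : HetProfunctor C D where
  obj X := L.obj X.1.unop ⟶ X.2
  map h := ↾fun ψ => L.map h.1.unop ≫ ψ ≫ h.2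

/-- The profunctor associated with an adjunction `L ⊣ U`, in the form `(c, d) ↦ hom_C(c, U d)`;
`ofAdjunctionIso` identifies it with `(c, d) ↦ hom_D(L c, d)`. -/
def ofAdjunction {L : C ⥤ D} {U : D ⥤ C} (_adj : L ⊣ U) : HetProfunctor C D :=
  ofRight U

/-- The adjunction bijection `hom_C(c, U d) ≃ hom_D(L c, d)` as an isomorphism of profunctors. -/
def ofAdjunctionIso {L : C ⥤ D} {U : D ⥤ C} (adj : L ⊣ U) :
    ofAdjunction adj ≅ ofLeft L :=
  NatIso.ofComponents (fun X => ((adj.homEquiv X.1.unop X.2).symm).toIso) (by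
    intro X Y h
    ext ψ
    exact (adj.homEquiv_naturality_left_symm h.1.unop _).trans
      (congrArg (L.map h.1.unop ≫ ·) (adj.homEquiv_naturality_right_symm _ h.2)))

end HetProfunctor

end

/-! The section `c ↦ (c, L c, η_c)` of the projection from the graph to `C` becomes inverse to it up
to the natural transformation `(𝟙, φ♯)`. The section `d ↦ (U d, d, 𝟙)` of the projection to `D` does
so up to `(φ, 𝟙)`. The result follows once natural transformations are known to induce homotopies of
classifying spaces (`homotopic_of_natTrans`).

A natural transformation gives a simplicial homotopy `X ⊗ Δ[1] ⟶ Y` of nerves. To realize it without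
comparing `|X ⊗ Δ[1]|` with a product, each `n`-simplex of `X` is given a map `Δⁿ × Δ¹ → |Y|`, glued
from the `n + 1` maximal simplices of the prism (`prismMap`). These maps respect simplicial
operators (`prismMap_map`), so their curried forms descend to `|X| → C(Δ¹, |Y|)`, and uncurrying
yields the homotopy. -/

namespace TopologicalSimplex

/-! ### Partial sums as coordinates on topological simplices. -/

open stdSimplex

/-- The sum of the barycentric coordinates of index less than `j`. -/
noncomputable def cum {m : ℕ} (t : stdSimplex ℝ (Fin m)) (j : ℕ) : ℝ :=
  ∑ i with (i : Fin m).val < j, t i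

lemma cum_zero {m : ℕ} (t : stdSimplex ℝ (Fin m)) : cum t 0 = 0 := by
  simp [cum]

lemma cum_of_le {m : ℕ} (t : stdSimplex ℝ (Fin m)) {j : ℕ} (hj : m ≤ j) : cum t j = 1 := by
  rw [cum, Finset.filter_true_of_mem (fun i _ ↦ i.2.trans_le hj), sum_eq_one]

lemma cum_mono {m : ℕ} (t : stdSimplex ℝ (Fin m)) : Monotone (cum t):= by
  intro i j hij
  refine Finset.sum_le_sum_of_subset_of_nonneg ?_ (fun _ _ _ ↦ by simp)
  intro x hx
  simp only [Finset.mem_filter, Finset.mem_univ, true_and] at hx ⊢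
  omega

lemma cum_succ {m : ℕ} (t : stdSimplex ℝ (Fin m)) (i : Fin m) :
    cum t (i + 1) = cum t i + t i := by
  have : (Finset.univ.filter fun x : Fin m ↦ x.val < i.val + 1) =
      insert i (Finset.univ.filter fun x : Fin m ↦ x.val < i.val) := by
    ext x
    simp only [Finset.mem_filter, Finset.mem_univ, true_and, Finset.mem_insert, Fin.ext_iff]
    omega
  rw [cum, this, Finset.sum_insert (by simp), add_comm]
  rfl

lemma ext_cum {m : ℕ} {t t' : stdSimplex ℝ (Fin m)} (h : ∀ j ≤ m, cum t j = cum t' j) :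
    t = t' := by
  ext i
  have h₁ := cum_succ t i
  have h₂ := cum_succ t' i
  rw [h _ (by omega), h _ (by omega)] at h₁
  linarith

lemma cum_map {m n : ℕ} (f : Fin m → Fin n) (t : stdSimplex ℝ (Fin m)) {j j' : ℕ}
    (h : ∀ i, (f i).val < j ↔ i.val < j') : cum (map f t) j = cum t j' := by
  classical
  simp only [cum, map_coe, FunOnFinite.linearMap_apply_apply]
  trans ∑ i with (i : Fin n).val < j, ∑ x with x.val < j' ∧ f x = i, t x
  · refine Finset.sum_congr rfl fun i hi ↦ Finset.sum_congr ?_ fun _ _ ↦ rfl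
    ext x
    simp only [Finset.mem_filter, Finset.mem_univ, true_and] at hi ⊢
    refine ⟨fun hx ↦ ⟨(h x).1 (hx ▸ hi), hx⟩, fun hx ↦ hx.2⟩
  · simp_rw [← Finset.filter_filter]
    exact Finset.sum_fiberwise_of_maps_to (fun x hx ↦ by simpa [h] using hx) _

/-- The point of the simplex with the given partial sums of barycentric coordinates. -/
def ofCum {m : ℕ} (F : ℕ → ℝ) (hF : Monotone F) (h₀ : F 0 = 0) (h₁ : F m = 1) :
    stdSimplex ℝ (Fin m) :=
  ⟨fun i ↦ F (i + 1) - F i, fun i ↦ sub_nonneg.2 (hF (Nat.le_succ _)), by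
    rw [Fin.sum_univ_eq_sum_range (fun i ↦ F (i + 1) - F i), Finset.sum_range_sub, h₀, h₁,
      sub_zero]⟩

lemma cum_ofCum {m : ℕ} (F : ℕ → ℝ) (hF : Monotone F) (h₀ : F 0 = 0) (h₁ : F m = 1)
    {j : ℕ} (hj : j ≤ m) : cum (ofCum F hF h₀ h₁) j = F j := by
  induction j with
  | zero => rw [cum_zero, h₀]
  | succ j ih =>
    have := cum_succ (ofCum F hF h₀ h₁) ⟨j, hj⟩
    dsimp only at this
    rw [this, ih (by omega)]
    change F j + (F (j + 1) - F j) = _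
    ring

end TopologicalSimplex

/-! ### Maximal chains of `⦋n⦌ × ⦋1⦌`. -/

namespace SimplexCategory

open Simplicial

variable {n : ℕ}

/-- The second coordinate of the maximal chain
`(0, 0) ≤ ⋯ ≤ (k, 0) ≤ (k, 1) ≤ ⋯ ≤ (n, 1)` of `⦋n⦌ × ⦋1⦌`; the first one is `σ k`. -/
abbrev prismSnd (k : Fin (n + 1)) : ⦋n + 1⦌ ⟶ ⦋1⦌ := toMk₁ k.succ.castSucc

/-- The hypotheses say that every `(a i, e i)` lies on the maximal chain that turns upwards at `k`.
Its position on that chain is `a i + e i`, which defines `b`. -/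
lemma exists_prism_factorization {p : ℕ} (a : ⦋p⦌ ⟶ ⦋n⦌) (e : ⦋p⦌ ⟶ ⦋1⦌) (k : Fin (n + 1))
    (h₀ : ∀ i, e i = 0 → a i ≤ k) (h₁ : ∀ i, e i = 1 → k ≤ a i) :
    ∃ b : ⦋p⦌ ⟶ ⦋n + 1⦌, b ≫ σ k = a ∧ b ≫ prismSnd k = e := by
  let b : ⦋p⦌ ⟶ ⦋n + 1⦌ := mkHom
    { toFun i := ⟨(a i).val + (e i).val, by have := (a i).2; have := (e i).2; simp at *; omega⟩
      monotone' i j hij :=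
        Nat.add_le_add (a.toOrderHom.monotone hij) (e.toOrderHom.monotone hij) }
  refine ⟨b, ?_, ?_⟩
  · ext i
    change (k.predAbove (b i)).val = (a i).val
    have hb : (b i).val = (a i).val + (e i).val := rfl
    obtain h | h : e i = 0 ∨ e i = 1 := by
      generalize e i = y
      revert y
      decide
    · have := h₀ i h
      rw [Fin.le_def] at this
      rw [Fin.predAbove_of_le_castSucc _ _ (by
        rw [Fin.le_def, Fin.val_castSucc]; simp only [hb, h]; simp; omega)]
      simp [hb, h]
    · have := h₁ i h
      rw [Fin.le_def] at this
      rw [Fin.predAbove_of_castSucc_lt _ _ (by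
        rw [Fin.lt_def, Fin.val_castSucc]; simp only [hb, h]; simp; omega)]
      simp [hb, h]
  · ext i
    change (prismSnd k (b i)).val = (e i).val
    have hb : (b i).val = (a i).val + (e i).val := rfl
    rw [toMk₁_apply]
    obtain h | h : e i = 0 ∨ e i = 1 := by
      generalize e i = y
      revert y
      decide
    · have := h₀ i h
      rw [Fin.le_def] at this
      rw [if_pos (by
        rw [Fin.lt_def, Fin.val_castSucc]; simp only [hb, h]; simp; omega), h]
    · have := h₁ i h
      rw [Fin.le_def] at this
      rw [if_neg (by
        rw [Fin.lt_def, Fin.val_castSucc]; simp only [hb, h]; simp; omega), h]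

end SimplexCategory

/-! ### Triangulation of the prism `Δⁿ × Δ¹`. -/

namespace TopologicalSimplex

open stdSimplex

open SimplexCategory Simplicial

variable {n : ℕ}

/-- The map of topological simplices induced by a morphism in the simplex category. -/
noncomputable def push {m n : ℕ} (f : (⦋m⦌ : SimplexCategory) ⟶ ⦋n⦌)
    (z : stdSimplex ℝ (Fin (m + 1))) : stdSimplex ℝ (Fin (n + 1)) :=
  map (X := Fin (m + 1)) (Y := Fin (n + 1)) (fun i ↦ f i) z

lemma push_comp {m n p : ℕ} (f : (⦋m⦌ : SimplexCategory) ⟶ ⦋n⦌)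
    (g : (⦋n⦌ : SimplexCategory) ⟶ ⦋p⦌) (z : stdSimplex ℝ (Fin (m + 1))) : push (f ≫ g) z = push g (push f z) := by
  unfold push
  rw [map_comp_apply]
  rfl

lemma continuous_push {m n : ℕ} (f : (⦋m⦌ : SimplexCategory) ⟶ ⦋n⦌) : Continuous (push f) := by
  unfold push
  exact continuous_map _

lemma cum_push_σ (k : Fin (n + 1)) (z : stdSimplex ℝ (Fin (n + 2))) (j : ℕ) :
    cum (push (σ k) z) j = cum z (if j ≤ k then j else j + 1) := by
  apply cum_map
  intro i
  change (k.predAbove i).val < j ↔ _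
  simp only [Fin.predAbove, Fin.lt_def, Fin.val_castSucc]
  split_ifs <;> simp only [Fin.val_pred, Fin.coe_castPred] <;> omega

lemma cum_push_prismSnd (k : Fin (n + 1)) (z : stdSimplex ℝ (Fin (n + 2))) :
    cum (push (prismSnd k) z) 1 = cum z (k + 1) := by
  apply cum_map
  intro i
  dsimp only
  rw [toMk₁_apply]
  simp only [Fin.lt_def, Fin.val_castSucc, Fin.val_succ]
  split_ifs <;> simp_all

/-- `σ k` merges the vertices `k` and `k + 1`, so it forgets only the partial sum at `k + 1`, which
is the one that `prismSnd k` records. -/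
lemma ext_prism {k : Fin (n + 1)} {z z' : stdSimplex ℝ (Fin (n + 2))}
    (h₁ : push (σ k) z = push (σ k) z') (h₂ : push (prismSnd k) z = push (prismSnd k) z') :
    z = z' := by
  apply ext_cum
  intro j _
  rcases lt_trichotomy j (k + 1) with h | rfl | h
  · simpa [cum_push_σ, show j ≤ k by omega] using congr_arg (cum · j) h₁
  · simpa [cum_push_prismSnd] using congr_arg (cum · 1) h₂
  · obtain ⟨j, rfl⟩ := Nat.exists_eq_add_of_lt h
    simpa [cum_push_σ, show ¬ (k + 1 + j ≤ k.val) by omega] using congr_arg (cum · (k + 1 + j)) h₁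

lemma exists_prism (t : stdSimplex ℝ (Fin (n + 1))) (s : stdSimplex ℝ (Fin 2)) :
    ∃ (k : Fin (n + 1)) (z : stdSimplex ℝ (Fin (n + 2))),
      push (σ k) z = t ∧ push (prismSnd k) z = s := by
  -- Otherwise all partial sums of `t` after the zeroth stay strictly below `cum s 1 ≤ 1`, although
  -- the last one is `1`.
  obtain ⟨k, hk₁, hk₂⟩ : ∃ k : Fin (n + 1), cum t k ≤ cum s 1 ∧ cum s 1 ≤ cum t (k + 1) := by
    by_contra! h
    have (j : ℕ) (hj : j ≤ n + 1) : cum t j ≤ cum s 1 ∧ (j ≠ 0 → cum t j < cum s 1) := by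
      induction j with
      | zero => simpa [cum_zero] using cum_mono s (Nat.zero_le 1)
      | succ j ih =>
        have := h ⟨j, by omega⟩ (ih (by omega)).1
        exact ⟨this.le, fun _ ↦ this⟩
    have h₁ := (this (n + 1) le_rfl).2 (by omega)
    rw [cum_of_le _ le_rfl] at h₁
    have h₂ := cum_mono s (show 1 ≤ 2 by omega)
    rw [cum_of_le s le_rfl] at h₂
    linarith
  -- The partial sums of `t`, with `cum s 1` inserted at position `k + 1`.
  let F (j : ℕ) : ℝ := if j ≤ k then cum t j else if j = k + 1 then cum s 1 else cum t (j - 1)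
  have hF : Monotone F := by
    refine monotone_nat_of_le_succ fun j ↦ ?_
    have := cum_mono t (Nat.le_succ j)
    have := cum_mono t (Nat.sub_le j 1)
    dsimp only [F]
    split_ifs <;> first | omega | simp_all
  have hF₀ : F 0 = 0 := by simp [F, cum_zero]
  have hF₁ : F (n + 2) = 1 := by
    simp [F, cum_of_le, show ¬ (n + 2 ≤ k.val) by omega, show ¬ (n + 1 = k.val) by omega]
  refine ⟨k, ofCum F hF hF₀ hF₁, ext_cum fun j hj ↦ ?_, ext_cum fun j hj ↦ ?_⟩
  · rw [cum_push_σ, cum_ofCum _ _ _ _ (by split_ifs <;> omega)]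
    dsimp only [F]
    split_ifs <;> first | omega | simp_all
  · obtain rfl | rfl | rfl : j = 0 ∨ j = 1 ∨ j = 2 := by omega
    · simp [cum_zero]
    · rw [cum_push_prismSnd, cum_ofCum _ _ _ _ (by omega)]
      simp [F]
    · simp [cum_of_le]

/-- The maximal simplices of the triangulated prism `Δⁿ × Δ¹`. -/
noncomputable def prism : C(Σ _ : Fin (n + 1), stdSimplex ℝ (Fin (n + 2)),
    stdSimplex ℝ (Fin (n + 1)) × stdSimplex ℝ (Fin 2)) where
  toFun z := (push (σ z.1) z.2, push (prismSnd z.1) z.2)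
  continuous_toFun :=
    continuous_sigma fun k ↦ (continuous_push (σ k)).prodMk (continuous_push (prismSnd k))

lemma prism_mk (k : Fin (n + 1)) (z : stdSimplex ℝ (Fin (n + 2))) :
    prism ⟨k, z⟩ = (push (σ k) z, push (prismSnd k) z) := by
  rfl

/-- A continuous surjection from a compact space to a Hausdorff space is closed, hence a quotient
map. -/
lemma isQuotientMap_prism : Topology.IsQuotientMap (prism (n := n)) := by
  refine prism.continuous.isClosedMap.isQuotientMap prism.continuous fun ⟨t, s⟩ ↦ ?_
  obtain ⟨k, z, rfl, rfl⟩ := exists_prism t s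
  exact ⟨⟨k, z⟩, rfl⟩

end TopologicalSimplex

namespace TopologicalSimplex

open stdSimplex

open SimplexCategory Simplicial

variable {n : ℕ}

lemma push_id (t : stdSimplex ℝ (Fin (n + 1))) : push (𝟙 ⦋n⦌) t = t :=
  map_id_apply t

lemma ext_cum_one {s s' : stdSimplex ℝ (Fin 2)} (h : cum s 1 = cum s' 1) : s = s' := by
  apply ext_cum
  intro j hj
  obtain rfl | rfl | rfl : j = 0 ∨ j = 1 ∨ j = 2 := by omega
  · simp [cum_zero]
  · exact h
  · simp [cum_of_le]

lemma cum_push_toMk₁ (j : Fin (n + 2)) (t : stdSimplex ℝ (Fin (n + 1))) :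
    cum (push (toMk₁ j) t) 1 = cum t j := by
  apply cum_map
  intro i
  dsimp only
  rw [toMk₁_apply]
  simp only [Fin.lt_def, Fin.val_castSucc]
  split_ifs <;> simp_all

lemma push_const_zero (t : stdSimplex ℝ (Fin (n + 1))) :
    push (const ⦋n⦌ ⦋1⦌ 0) t = vertex 0 := by
  apply ext_cum_one
  have h₁ : cum (push (const ⦋n⦌ ⦋1⦌ 0) t) 1 = cum t (n + 1) :=
    cum_map _ _ fun i ↦ ⟨fun _ ↦ i.2, fun _ ↦ Nat.one_pos⟩
  have h₂ := cum_succ (vertex (S := ℝ) (0 : Fin 2)) 0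
  simp only [Fin.val_zero, cum_zero, zero_add, vertex_coe, Pi.single_eq_same] at h₂
  rw [h₁, h₂, cum_of_le _ le_rfl]

lemma push_const_one (t : stdSimplex ℝ (Fin (n + 1))) :
    push (const ⦋n⦌ ⦋1⦌ 1) t = vertex 1 := by
  apply ext_cum_one
  have h₁ : cum (push (const ⦋n⦌ ⦋1⦌ 1) t) 1 = cum t 0 :=
    cum_map _ _ fun i ↦ ⟨fun h ↦ absurd h (lt_irrefl 1), fun h ↦ absurd h (Nat.not_lt_zero _)⟩
  have h₂ := cum_succ (vertex (S := ℝ) (1 : Fin 2)) 0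
  simp only [Fin.val_zero, cum_zero, zero_add, vertex_coe] at h₂
  rw [h₁, h₂, cum_zero, Pi.single_eq_of_ne (by decide)]

end TopologicalSimplex

namespace SimplexCategory

open Simplicial

lemma δ_succ_comp_prismSnd {n : ℕ} (j : Fin (n + 1)) :
    δ j.succ ≫ prismSnd j = toMk₁ j.succ := by
  rw [δ_comp_toMk₁_of_le _ _ (by simp)]
  rfl

lemma δ_castSucc_comp_prismSnd {n : ℕ} (j : Fin (n + 1)) :
    δ j.castSucc ≫ prismSnd j = toMk₁ j.castSucc := by
  rw [δ_comp_toMk₁_of_lt _ _ (by simp)]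
  simp

lemma σ_le_of_prismSnd_eq_zero {n : ℕ} (k : Fin (n + 1)) (i : Fin (n + 2))
    (hi : prismSnd k i = 0) : σ k i ≤ k := by
  rw [toMk₁_apply_eq_zero_iff, Fin.lt_def, Fin.val_castSucc, Fin.val_castSucc,
    Fin.val_succ] at hi
  change k.predAbove i ≤ k
  rw [Fin.predAbove_of_le_castSucc _ _ (by rw [Fin.le_def, Fin.val_castSucc]; omega), Fin.le_def,
    Fin.coe_castPred]
  omega

lemma le_σ_of_prismSnd_eq_one {n : ℕ} (k : Fin (n + 1)) (i : Fin (n + 2))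
    (hi : prismSnd k i = 1) : k ≤ σ k i := by
  rw [toMk₁_apply_eq_one_iff, Fin.le_def, Fin.val_castSucc, Fin.val_castSucc,
    Fin.val_succ] at hi
  change k ≤ k.predAbove i
  rw [Fin.predAbove_of_castSucc_lt _ _ (by rw [Fin.lt_def, Fin.val_castSucc]; omega), Fin.le_def,
    Fin.val_pred]
  omega

end SimplexCategory

open TopologicalSimplex Simplicial MonoidalCategory SimplexCategory

/-! ### Realization of simplicial homotopies. -/

namespace SSet

variable {X Y : SSet.{u}} {n m p : ℕ}

/-- The map from the topological simplex to the geometric realization of a simplicial set which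
corresponds to a simplex. -/
noncomputable def charMap (y : Y _⦋n⦌) : C(_root_.stdSimplex ℝ (Fin (n + 1)), |Y|) :=
  TopCat.toSSetObjEquiv _ (op ⦋n⦌) ((sSetTopAdj.unit.app Y).app (op ⦋n⦌) y)

lemma charMap_map (y : Y _⦋n⦌) (f : (⦋m⦌ : SimplexCategory) ⟶ ⦋n⦌)
    (z : _root_.stdSimplex ℝ (Fin (m + 1))) :
    charMap (Y.map f.op y) z = charMap y (push f z) := by
  unfold charMap
  have := ConcreteCategory.congr_hom ((sSetTopAdj.unit.app Y).naturality f.op) y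
  exact DFunLike.congr_fun (congr_arg (TopCat.toSSetObjEquiv _ (op ⦋m⦌)) this) z

lemma toTop_map_charMap (f : X ⟶ Y) (x : X _⦋n⦌) (z : _root_.stdSimplex ℝ (Fin (n + 1))) :
    SSet.toTop.map f (charMap x z) = charMap (f.app _ x) z := by
  have := ConcreteCategory.congr_hom (NatTrans.congr_app (sSetTopAdj.unit.naturality f) (op ⦋n⦌)) x
  unfold charMap
  exact DFunLike.congr_fun (congr_arg (TopCat.toSSetObjEquiv _ (op ⦋n⦌)) this.symm) z

/-- The continuous map from a geometric realization given by a compatible family of maps on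
topological simplices. -/
noncomputable def descTop {T : TopCat.{u}}
    (φ : ∀ ⦃n : ℕ⦄, X _⦋n⦌ → C(_root_.stdSimplex ℝ (Fin (n + 1)), T))
    (hφ : ∀ ⦃n m : ℕ⦄ (x : X _⦋n⦌) (f : (⦋m⦌ : SimplexCategory) ⟶ ⦋n⦌) (z),
      φ (X.map f.op x) z = φ x (push f z)) : |X| ⟶ T :=
  (sSetTopAdj.homEquiv X T).symm
    { app k := ↾fun x ↦ (TopCat.toSSetObjEquiv T k).symm (φ (n := k.unop.len) x)
      naturality k l f := by
        ext x
        apply (TopCat.toSSetObjEquiv T l).injective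
        ext z
        exact hφ x f.unop z }

lemma homEquiv_app {T : TopCat.{u}} (f : |X| ⟶ T) (x : X _⦋n⦌)
    (z : _root_.stdSimplex ℝ (Fin (n + 1))) :
    TopCat.toSSetObjEquiv T (op ⦋n⦌) ((sSetTopAdj.homEquiv X T f).app (op ⦋n⦌) x) z =
      f (charMap x z) := by
  rw [Adjunction.homEquiv_unit]
  rfl

lemma descTop_charMap {T : TopCat.{u}}
    (φ : ∀ ⦃n : ℕ⦄, X _⦋n⦌ → C(_root_.stdSimplex ℝ (Fin (n + 1)), T))
    (hφ : ∀ ⦃n m : ℕ⦄ (x : X _⦋n⦌) (f : (⦋m⦌ : SimplexCategory) ⟶ ⦋n⦌) (z),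
      φ (X.map f.op x) z = φ x (push f z)) (x : X _⦋n⦌) (z) :
    descTop φ hφ (charMap x z) = φ x z := by
  rw [← homEquiv_app, descTop, Equiv.apply_symm_apply]
  rfl

lemma toTop_hom_ext {T : TopCat.{u}} {f g : |X| ⟶ T}
    (h : ∀ ⦃n : ℕ⦄ (x : X _⦋n⦌) (z), f (charMap x z) = g (charMap x z)) : f = g := by
  apply (sSetTopAdj.homEquiv X T).injective
  ext k x
  induction k using Opposite.rec with | _ k
  induction k using SimplexCategory.rec with | _ n
  apply (TopCat.toSSetObjEquiv T _).injective
  ext z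
  exact (homEquiv_app f x z).trans ((h x z).trans (homEquiv_app g x z).symm)

section

variable (H : X ⊗ Δ[1] ⟶ Y)

/-- The image by `H` of the simplex of `X ⊗ Δ[1]` obtained from an `n`-simplex of `X` and a
simplex of `Δ[n] ⊗ Δ[1]`. -/
def prismSimplex (x : X _⦋n⦌) (a : (⦋p⦌ : SimplexCategory) ⟶ ⦋n⦌)
    (e : (⦋p⦌ : SimplexCategory) ⟶ ⦋1⦌) : Y _⦋p⦌ :=
  H.app (op ⦋p⦌) (X.map a.op x, stdSimplex.objEquiv.symm e)

lemma map_prismSimplex (x : X _⦋n⦌) (a : (⦋p⦌ : SimplexCategory) ⟶ ⦋n⦌)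
    (e : (⦋p⦌ : SimplexCategory) ⟶ ⦋1⦌) (b : (⦋m⦌ : SimplexCategory) ⟶ ⦋p⦌) :
    Y.map b.op (prismSimplex H x a e) = prismSimplex H x (b ≫ a) (b ≫ e) := by
  unfold prismSimplex
  rw [op_comp, Functor.map_comp_apply]
  exact (ConcreteCategory.congr_hom (H.naturality b.op)
    (show (X ⊗ Δ[1] : SSet.{u}) _⦋p⦌ from (X.map a.op x, stdSimplex.objEquiv.symm e))).symm

lemma prismSimplex_map (x : X _⦋n⦌) (f : (⦋m⦌ : SimplexCategory) ⟶ ⦋n⦌)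
    (a : (⦋p⦌ : SimplexCategory) ⟶ ⦋m⦌) (e : (⦋p⦌ : SimplexCategory) ⟶ ⦋1⦌) :
    prismSimplex H (X.map f.op x) a e = prismSimplex H x (a ≫ f) e := by
  unfold prismSimplex
  rw [op_comp, Functor.map_comp_apply]

lemma charMap_prismSimplex_comp (x : X _⦋n⦌) (a : (⦋p⦌ : SimplexCategory) ⟶ ⦋n⦌)
    (e : (⦋p⦌ : SimplexCategory) ⟶ ⦋1⦌) (b : (⦋m⦌ : SimplexCategory) ⟶ ⦋p⦌) (z) :
    charMap (prismSimplex H x (b ≫ a) (b ≫ e)) z = charMap (prismSimplex H x a e) (push b z) := by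
  rw [← map_prismSimplex, charMap_map]

lemma charMap_prismSimplex_succ (x : X _⦋n⦌) (j : Fin (n + 1)) (t) :
    charMap (prismSimplex H x (𝟙 _) (toMk₁ j.succ)) t =
      charMap (prismSimplex H x (σ j) (prismSnd j)) (push (δ j.succ) t) := by
  rw [← charMap_prismSimplex_comp, δ_comp_σ_succ, δ_succ_comp_prismSnd]

lemma charMap_prismSimplex_castSucc (x : X _⦋n⦌) (j : Fin (n + 1)) (t) :
    charMap (prismSimplex H x (𝟙 _) (toMk₁ j.castSucc)) t =
      charMap (prismSimplex H x (σ j) (prismSnd j)) (push (δ j.castSucc) t) := by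
  rw [← charMap_prismSimplex_comp, δ_comp_σ_self, δ_castSucc_comp_prismSnd]

/-- The two sections of the prism differ only over the vertices `i, …, j - 1`, where `t` has no
mass. Consecutive sections are two faces of one maximal simplex, in which the two images of `t`
coincide. -/
lemma charMap_prismSimplex_eq_of_cum_eq (x : X _⦋n⦌) (i j : Fin (n + 2)) (hij : i ≤ j) (t)
    (h : cum t i = cum t j) :
    charMap (prismSimplex H x (𝟙 _) (toMk₁ i)) t =
      charMap (prismSimplex H x (𝟙 _) (toMk₁ j)) t := by
  induction j using Fin.induction with
  | zero => rw [Fin.le_zero_iff.1 hij]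
  | succ j ih =>
    obtain rfl | hlt := hij.eq_or_lt
    · rfl
    have hij' : i ≤ j.castSucc := Fin.le_castSucc_iff.2 hlt
    have h₁ := cum_mono t (show i.val ≤ j.val from hij')
    have h₂ := cum_mono t (Nat.le_succ j.val)
    rw [Fin.val_succ] at h
    have h₃ : cum t i = cum t j := by linarith
    rw [ih hij' h₃, charMap_prismSimplex_succ, charMap_prismSimplex_castSucc]
    congr 1
    apply ext_prism (k := j)
    · rw [← push_comp, ← push_comp, δ_comp_σ_succ, δ_comp_σ_self]
    · apply ext_cum_one
      rw [← push_comp, ← push_comp, δ_succ_comp_prismSnd, δ_castSucc_comp_prismSnd,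
        cum_push_toMk₁, cum_push_toMk₁,
        Fin.val_succ, Fin.val_castSucc]
      linarith

lemma charMap_prismSimplex_eq_of_lt (x : X _⦋n⦌) {k l : Fin (n + 1)} (hkl : k < l)
    {z z' : _root_.stdSimplex ℝ (Fin (n + 2))} (h₁ : push (σ k) z = push (σ l) z')
    (h₂ : push (prismSnd k) z = push (prismSnd l) z') :
    charMap (prismSimplex H x (σ k) (prismSnd k)) z =
      charMap (prismSimplex H x (σ l) (prismSnd l)) z' := by
  obtain ⟨t, ht⟩ : ∃ t, t = push (σ k) z := ⟨_, rfl⟩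
  have hkl' : k.val + 1 ≤ l.val := hkl
  -- With `s` the common second coordinate, `cum s 1 = cum z (k + 1) ≤ cum z (k + 2) = cum t (k + 1)
  -- ≤ cum t l = cum z' l ≤ cum z' (l + 1) = cum s 1`. Hence all are equal: `z` and `z'` lie on
  -- faces that are sections of the prism, both over `t`.
  have e₁ := cum_push_prismSnd k z
  have e₂ := cum_mono z (Nat.le_succ (k + 1))
  have e₃ := cum_push_σ k z (k + 1)
  rw [if_neg (by omega), ← ht] at e₃
  have e₄ := cum_mono t hkl'
  have e₅ := cum_push_σ l z' l
  rw [if_pos le_rfl, ← h₁, ← ht] at e₅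
  have e₆ := cum_mono z' (Nat.le_succ l)
  have e₇ := cum_push_prismSnd l z'
  rw [← h₂] at e₇
  dsimp only [Nat.succ_eq_add_one] at e₂ e₆
  have hz : z = push (δ k.succ) t := by
    apply ext_prism (k := k)
    · rw [← push_comp, δ_comp_σ_succ, push_id, ht]
    · apply ext_cum_one
      rw [← push_comp, δ_succ_comp_prismSnd, cum_push_toMk₁, cum_push_toMk₁,
        Fin.val_castSucc, Fin.val_succ]
      linarith
  have hz' : z' = push (δ l.castSucc) t := by
    apply ext_prism (k := l)
    · rw [← push_comp, δ_comp_σ_self, push_id, ht, h₁]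
    · apply ext_cum_one
      rw [← push_comp, δ_castSucc_comp_prismSnd, cum_push_toMk₁, cum_push_toMk₁,
        Fin.val_castSucc, Fin.val_castSucc, Fin.val_succ]
      linarith
  rw [hz, hz', ← charMap_prismSimplex_succ, ← charMap_prismSimplex_castSucc]
  apply charMap_prismSimplex_eq_of_cum_eq
  · exact hkl
  · rw [Fin.val_succ, Fin.val_castSucc]
    linarith

/-- The realizations of the images of the maximal simplices of the triangulated prism. -/
noncomputable def prismPieces (x : X _⦋n⦌) :
    C(Σ _ : Fin (n + 1), _root_.stdSimplex ℝ (Fin (n + 2)), |Y|) where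
  toFun z := charMap (prismSimplex H x (σ z.1) (prismSnd z.1)) z.2
  continuous_toFun := continuous_sigma fun k ↦
    map_continuous (charMap (prismSimplex H x (σ k) (prismSnd k)))

lemma factorsThrough_prismPieces (x : X _⦋n⦌) :
    Function.FactorsThrough (prismPieces H x) prism := by
  rintro ⟨k, z⟩ ⟨l, z'⟩ h
  obtain ⟨h₁, h₂⟩ := Prod.ext_iff.1 h
  obtain h | h | h := lt_trichotomy k l
  · exact charMap_prismSimplex_eq_of_lt H x h h₁ h₂
  · obtain rfl := h
    obtain rfl := ext_prism h₁ h₂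
    rfl
  · exact (charMap_prismSimplex_eq_of_lt H x h h₁.symm h₂.symm).symm

/-- The map `Δⁿ × Δ¹ → |Y|` obtained by gluing the realizations of the simplices of the
triangulated prism. -/
noncomputable def prismMap (x : X _⦋n⦌) :
    C(_root_.stdSimplex ℝ (Fin (n + 1)) × _root_.stdSimplex ℝ (Fin 2), |Y|) :=
  isQuotientMap_prism.lift (prismPieces H x) (factorsThrough_prismPieces H x)

lemma prismMap_prism (x : X _⦋n⦌) (k : Fin (n + 1)) (z) :
    prismMap H x (push (σ k) z, push (prismSnd k) z) =
      charMap (prismSimplex H x (σ k) (prismSnd k)) z := by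
  have : (prismMap H x).comp prism = prismPieces H x :=
    isQuotientMap_prism.lift_comp (prismPieces H x) (factorsThrough_prismPieces H x)
  rw [← prism_mk, ← ContinuousMap.comp_apply, this]
  rfl

lemma prismMap_push (x : X _⦋n⦌) (a : (⦋p⦌ : SimplexCategory) ⟶ ⦋n⦌)
    (e : (⦋p⦌ : SimplexCategory) ⟶ ⦋1⦌) (k : Fin (n + 1))
    (h₀ : ∀ i, e i = 0 → a i ≤ k) (h₁ : ∀ i, e i = 1 → k ≤ a i) (z) :
    prismMap H x (push a z, push e z) = charMap (prismSimplex H x a e) z := by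
  obtain ⟨b, rfl, rfl⟩ := exists_prism_factorization a e k h₀ h₁
  rw [charMap_prismSimplex_comp, push_comp, push_comp, prismMap_prism]

/-- By monotonicity, `f` carries the maximal chain turning at `k` into the one turning at `f k`. -/
lemma prismMap_map (x : X _⦋n⦌) (f : (⦋m⦌ : SimplexCategory) ⟶ ⦋n⦌) (t s) :
    prismMap H (X.map f.op x) (t, s) = prismMap H x (push f t, s) := by
  obtain ⟨k, z, rfl, rfl⟩ := exists_prism t s
  rw [prismMap_prism, prismSimplex_map, ← push_comp, prismMap_push (k := f k)]
  · exact fun i hi ↦ f.toOrderHom.monotone (σ_le_of_prismSnd_eq_zero k i hi)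
  · exact fun i hi ↦ f.toOrderHom.monotone (le_σ_of_prismSnd_eq_one k i hi)

/-- A simplicial homotopy induces a map from `|X|` to the space of paths in `|Y|`
parametrized by the topological `1`-simplex. -/
noncomputable def toTopPath : |X| ⟶ TopCat.of C(_root_.stdSimplex ℝ (Fin 2), |Y|) :=
  descTop (fun _ x ↦ (prismMap H x).curry) fun _ _ x f z ↦ by
    ext s
    exact prismMap_map H x f z s

lemma toTopPath_charMap (x : X _⦋n⦌) (t s) :
    toTopPath H (charMap x t) s = prismMap H x (t, s) := by
  rw [toTopPath, descTop_charMap]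
  rfl

lemma prismMap_vertex_zero (x : X _⦋n⦌) (t) :
    prismMap H x (t, stdSimplex.vertex 0) = charMap ((ι₀ ≫ H).app _ x) t := by
  -- The whole bottom row lies on the chain that turns at `n`; dually, the top row lies on the one
  -- that turns at `0`.
  have := prismMap_push H x (𝟙 _) (SimplexCategory.const ⦋n⦌ ⦋1⦌ 0) (Fin.last n)
    (fun _ _ ↦ Fin.le_last _) (fun i hi ↦ absurd (show (0 : Fin 2) = 1 from hi) (by decide)) t
  rw [push_id, push_const_zero] at this
  rw [this, prismSimplex, op_id, CategoryTheory.Functor.map_id_apply]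
  rfl

lemma prismMap_vertex_one (x : X _⦋n⦌) (t) :
    prismMap H x (t, stdSimplex.vertex 1) = charMap ((ι₁ ≫ H).app _ x) t := by
  have := prismMap_push H x (𝟙 _) (SimplexCategory.const ⦋n⦌ ⦋1⦌ 1) 0
    (fun i hi ↦ absurd (show (1 : Fin 2) = 0 from hi) (by decide)) (fun _ _ ↦ Fin.zero_le _) t
  rw [push_id, push_const_one] at this
  rw [this, prismSimplex, op_id, CategoryTheory.Functor.map_id_apply]
  rfl

lemma toTopPath_vertex_zero (a : |X|) :
    toTopPath H a (stdSimplex.vertex 0) = SSet.toTop.map (ι₀ ≫ H) a := by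
  let ev : TopCat.of C(_root_.stdSimplex ℝ (Fin 2), |Y|) ⟶ |Y| :=
    TopCat.ofHom ⟨fun γ ↦ γ (stdSimplex.vertex 0), continuous_eval_const _⟩
  have : toTopPath H ≫ ev = SSet.toTop.map (ι₀ ≫ H) := toTop_hom_ext fun n x z ↦ by
    rw [toTop_map_charMap, ← prismMap_vertex_zero, ← toTopPath_charMap]
    rfl
  exact ConcreteCategory.congr_hom this a

lemma toTopPath_vertex_one (a : |X|) :
    toTopPath H a (stdSimplex.vertex 1) = SSet.toTop.map (ι₁ ≫ H) a := by
  let ev : TopCat.of C(_root_.stdSimplex ℝ (Fin 2), |Y|) ⟶ |Y| :=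
    TopCat.ofHom ⟨fun γ ↦ γ (stdSimplex.vertex 1), continuous_eval_const _⟩
  have : toTopPath H ≫ ev = SSet.toTop.map (ι₁ ≫ H) := toTop_hom_ext fun n x z ↦ by
    rw [toTop_map_charMap, ← prismMap_vertex_one, ← toTopPath_charMap]
    rfl
  exact ConcreteCategory.congr_hom this a

/-- The geometric realizations of the two ends of a simplicial homotopy are homotopic. -/
theorem homotopic_toTop_map :
    (SSet.toTop.map (ι₀ ≫ H)).hom.Homotopic (SSet.toTop.map (ι₁ ≫ H)).hom :=
  ⟨{ toFun q := toTopPath H q.2 (stdSimplexHomeomorphUnitInterval.symm q.1)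
     continuous_toFun := by
       -- Uncurrying is continuous because `Δ¹` is locally compact; nothing is needed of `|X|`.
       have : Continuous fun q : |X| × _root_.stdSimplex ℝ (Fin 2) ↦ toTopPath H q.1 q.2 :=
         ContinuousMap.continuous_uncurry_of_continuous (toTopPath H).hom
       exact this.comp (continuous_snd.prodMk
         (stdSimplexHomeomorphUnitInterval.symm.continuous.comp continuous_fst))
     map_zero_left a := by
       rw [← stdSimplexHomeomorphUnitInterval_zero, Homeomorph.symm_apply_apply]
       exact toTopPath_vertex_zero H a
     map_one_left a := by
       rw [← stdSimplexHomeomorphUnitInterval_one, Homeomorph.symm_apply_apply]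
       exact toTopPath_vertex_one H a }⟩

end

end SSet

/-! ### Natural transformations and classifying spaces. -/

section
open Simplicial MonoidalCategory

variable {C D : Type u} [SmallCategory C] [SmallCategory D]

/-- The simplicial homotopy `nerve C ⊗ Δ[1] ⟶ nerve D` induced by a natural transformation. -/
def nerveHomotopy {F G : C ⥤ D} (α : F ⟶ G) : nerve C ⊗ Δ[1] ⟶ nerve D where
  app _ := ↾fun q ↦
    Functor.prod' (SimplexCategory.toCat.map (SSet.stdSimplex.objEquiv q.2)).toFunctor q.1 ⋙
      Functor.uncurry.obj (ComposableArrows.mk₁ α)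
  naturality _ _ _ := rfl

lemma ι₀_nerveHomotopy {F G : C ⥤ D} (α : F ⟶ G) : SSet.ι₀ ≫ nerveHomotopy α = nerveMap F := by
  ext k x
  refine CategoryTheory.Functor.ext (fun i ↦ rfl) fun i j f ↦ ?_
  have h : ((ComposableArrows.mk₁ α).map (𝟙 (0 : Fin 2))).app (x.obj i) ≫ F.map (x.map f) =
      F.map (x.map f) := by
    rw [CategoryTheory.Functor.map_id]
    exact Category.id_comp _
  refine Eq.trans h ?_
  -- The `eqToHom` factors are identities, since the functors agree definitionally on objects.
  exact ((Category.id_comp _).trans (Category.comp_id _)).symm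

lemma ι₁_nerveHomotopy {F G : C ⥤ D} (α : F ⟶ G) : SSet.ι₁ ≫ nerveHomotopy α = nerveMap G := by
  ext k x
  refine CategoryTheory.Functor.ext (fun i ↦ rfl) fun i j f ↦ ?_
  have h : ((ComposableArrows.mk₁ α).map (𝟙 (1 : Fin 2))).app (x.obj i) ≫ G.map (x.map f) =
      G.map (x.map f) := by
    rw [CategoryTheory.Functor.map_id]
    exact Category.id_comp _
  refine Eq.trans h ?_
  exact ((Category.id_comp _).trans (Category.comp_id _)).symm

/-- Functors related by a natural transformation induce homotopic maps of classifying spaces. -/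
theorem homotopic_of_natTrans {F G : C ⥤ D} (α : F ⟶ G) :
    (SSet.toTop.map (nerveMap F)).hom.Homotopic (SSet.toTop.map (nerveMap G)).hom := by
  rw [← ι₀_nerveHomotopy α, ← ι₁_nerveHomotopy α]
  exact SSet.homotopic_toTop_map _

/-- Functors `F` and `G` in opposite directions, with natural transformations as for the unit and
counit of an adjunction, induce a homotopy equivalence of classifying spaces. -/
theorem nonempty_homotopyEquiv_classifyingSpace (F : C ⥤ D) (G : D ⥤ C) (α : 𝟭 C ⟶ F ⋙ G)
    (β : G ⋙ F ⟶ 𝟭 D) : Nonempty (ClassifyingSpace C ≃ₕ ClassifyingSpace D) := by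
  have comp {A B E : Type u} [SmallCategory A] [SmallCategory B] [SmallCategory E]
      (S : A ⥤ B) (T : B ⥤ E) : (SSet.toTop.map (nerveMap (S ⋙ T))).hom =
        (SSet.toTop.map (nerveMap T)).hom.comp (SSet.toTop.map (nerveMap S)).hom := by
    rw [← TopCat.hom_comp, ← Functor.map_comp]
    rfl
  have id (A : Type u) [SmallCategory A] :
      (SSet.toTop.map (nerveMap (𝟭 A))).hom = ContinuousMap.id _ := by
    rw [← TopCat.hom_id, ← CategoryTheory.Functor.map_id]
    rfl
  refine ⟨⟨(SSet.toTop.map (nerveMap F)).hom, (SSet.toTop.map (nerveMap G)).hom, ?_, ?_⟩⟩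
  · rw [← comp, ← id]
    exact (homotopic_of_natTrans α).symm
  · rw [← comp, ← id]
    exact homotopic_of_natTrans β

end

/-! ### The graph of an adjunction. -/

namespace HetProfunctor

variable {C D : Type u} [SmallCategory C] [SmallCategory D] {L : C ⥤ D} {U : D ⥤ C} (adj : L ⊣ U)

lemma precomp_ofAdjunction {c' c : C} {d : D} (f : c' ⟶ c) (φ : (ofAdjunction adj).Het c d) :
    precomp f φ = (f ≫ (show c ⟶ U.obj d from φ) : c' ⟶ U.obj d) := by
  change f ≫ φ ≫ U.map (𝟙 d) = _
  rw [U.map_id]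
  exact congr_arg (f ≫ ·) (Category.comp_id _)

lemma postcomp_ofAdjunction {c : C} {d d' : D} (g : d ⟶ d') (φ : (ofAdjunction adj).Het c d) :
    postcomp g φ = ((show c ⟶ U.obj d from φ) ≫ U.map g : c ⟶ U.obj d') :=
  Category.id_comp (X := c) (Y := U.obj d') (φ ≫ U.map g)

namespace Graph

variable {adj}

/-- Morphisms in the graph of the profunctor of an adjunction, as commutative squares. -/
def homMk {X Y : (ofAdjunction adj).Graph} (f : X.c ⟶ Y.c) (g : X.d ⟶ Y.d)
    (w : (show X.c ⟶ U.obj X.d from X.φ) ≫ U.map g = f ≫ (show Y.c ⟶ U.obj Y.d from Y.φ)) :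
    X ⟶ Y :=
  ⟨f, g, by rw [precomp_ofAdjunction, postcomp_ofAdjunction, w]⟩

lemma hom_w {X Y : (ofAdjunction adj).Graph} (h : X ⟶ Y) :
    (show X.c ⟶ U.obj X.d from X.φ) ≫ U.map h.g = h.f ≫ (show Y.c ⟶ U.obj Y.d from Y.φ) := by
  rw [← postcomp_ofAdjunction, h.w, precomp_ofAdjunction]

variable (adj)

/-- The projection of the graph to the source category. -/
def toSource : (ofAdjunction adj).Graph ⥤ C where
  obj X := X.c
  map h := h.f

/-- The projection of the graph to the target category. -/
def toTarget : (ofAdjunction adj).Graph ⥤ D where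
  obj X := X.d
  map h := h.g

/-- The section `c ↦ (c, L c, η_c)` of the projection to the source category. -/
def ofSource : C ⥤ (ofAdjunction adj).Graph where
  obj c := ⟨c, L.obj c, adj.unit.app c⟩
  map f := homMk f (L.map f) (adj.unit.naturality f).symm
  map_id c := Hom.ext rfl (L.map_id c)
  map_comp f g := Hom.ext rfl (L.map_comp f g)

/-- The section `d ↦ (U d, d, 𝟙)` of the projection to the target category. -/
def ofTarget : D ⥤ (ofAdjunction adj).Graph where
  obj d := ⟨U.obj d, d, 𝟙 (U.obj d)⟩
  map g := homMk (U.map g) g ((Category.id_comp _).trans (Category.comp_id _).symm)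
  map_id d := Hom.ext (U.map_id d) rfl
  map_comp f g := Hom.ext (U.map_comp f g) rfl

/-- The natural transformation with components
`(𝟙, φ♯) : (c, L c, η_c) ⟶ (c, d, φ)`, where `φ♯` is the transpose of `φ`. -/
def toSourceCompOfSource : toSource adj ⋙ ofSource adj ⟶ 𝟭 _ where
  app X := homMk (𝟙 X.c) ((adj.homEquiv X.c X.d).symm X.φ) (by
    have := (adj.homEquiv X.c X.d).apply_symm_apply X.φ
    rw [adj.homEquiv_unit] at this
    exact this.trans (Category.id_comp (X := X.c) (Y := U.obj X.d) X.φ).symm)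
  naturality X Y h := Hom.ext ((Category.comp_id _).trans (Category.id_comp _).symm)
    ((adj.homEquiv_naturality_left_symm h.f Y.φ).symm.trans
      ((congr_arg (adj.homEquiv X.c Y.d).symm (hom_w h).symm).trans
        (adj.homEquiv_naturality_right_symm X.φ h.g)))

/-- The natural transformation with components `(φ, 𝟙) : (c, d, φ) ⟶ (U d, d, 𝟙)`. -/
def toTargetCompOfTarget : 𝟭 _ ⟶ toTarget adj ⋙ ofTarget adj where
  app X := homMk X.φ (𝟙 X.d)
    (congr_arg ((show X.c ⟶ U.obj X.d from X.φ) ≫ ·) (U.map_id X.d))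
  naturality _ _ h := Hom.ext (hom_w h).symm ((Category.comp_id _).trans (Category.id_comp _).symm)

end Graph

end HetProfunctor

theorem theorem5p2 {C D : Type u} [SmallCategory C] [SmallCategory D]
    {L : C ⥤ D} {U : D ⥤ C} (adj : L ⊣ U) :
    Nonempty (ClassifyingSpace C ≃ₕ
        ClassifyingSpace (HetProfunctor.ofAdjunction adj).Graph) ∧
      Nonempty (ClassifyingSpace (HetProfunctor.ofAdjunction adj).Graph ≃ₕ
        ClassifyingSpace D) :=
  -- Each section followed by its projection is the identity functor by definition, so `𝟙 _` serves
  -- as one of the two transformations.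
  ⟨nonempty_homotopyEquiv_classifyingSpace (HetProfunctor.Graph.ofSource adj)
      (HetProfunctor.Graph.toSource adj) (𝟙 _) (HetProfunctor.Graph.toSourceCompOfSource adj),
    nonempty_homotopyEquiv_classifyingSpace (HetProfunctor.Graph.toTarget adj)
      (HetProfunctor.Graph.ofTarget adj) (HetProfunctor.Graph.toTargetCompOfTarget adj) (𝟙 _)⟩
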